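/- Fix an integer $D\ge 1$, energies $E_0,\dots,E_D\in\mathbb{R}$ and $\beta\in\mathbb{R}$. Plane trees are finite rooted trees in which the subtrees at the children of every vertex are linearly ordered; all trees below have branching number (number of children) at most $D$ at each vertex. Let $\mathbb{T}_N$ be the set of these trees with $N$ vertices, let $E(T)=\sum_{v\in V(T)}E_{\deg(v)}$, where $\deg(v)$ is the branching number of $v$, and let $\mu_N$ be the probability measure on $\mathbb{T}_N$ ($N\ge 1$) with $\mu_N\{T\}=e^{-\beta E(T)}/\sum_{T'\in\mathbb{T}_N}e^{-\beta E(T')}$. For $n\ge 0$ let $S_n$ be the set of these trees of height exactly $n$, and let $\pi_n$ map a tree to the subtree spanned by its vertices at distance at most $n$ from the root; for all sufficiently large $N$, $\pi_n$ maps $\mathbb{T}_N$ into $S_n$. Then for every $n$ the measures $\mu_N\pi_n^{-1}$ on $S_n$ converge in total variation, as $N\to\infty$, to a unique probability measure $P_n$ on $S_n$, and the family $(P_n)$ is consistent: for every $n$ and every $\tau\in S_n$, $$P_n\{\tau\}=\sum_{\substack{\tau'\in S_{n+1}\\ \pi_n\tau'=\tau}}P_{n+1}\{\tau'\}.$$ 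-/

import Mathlib

open MeasureTheory Filter Topology

noncomputable section

/-- Finite plane (rooted, ordered) trees all of whose vertices have at most `D` children:
`node k c` is the tree whose root has `k ≤ D` children, the subtrees at the children being, in
order, `c 0, …, c (k - 1)`. -/
inductive PlaneTree (D : ℕ) : Type where
  | node (k : Fin (D + 1)) (c : Fin (k : ℕ) → PlaneTree D) : PlaneTree D

namespace PlaneTree

variable {D : ℕ}

/-- The multiset of the branching numbers of all the vertices of a tree, one entry for each
vertex. -/
def degrees : PlaneTree D → Multiset (Fin (D + 1))
  | node k c => k ::ₘ ∑ i, (c i).degrees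

/-- The number of vertices. -/
def order (T : PlaneTree D) : ℕ := T.degrees.card

/-- The energy `∑ v, E (deg v)`, the sum being over all vertices `v`. -/
def energy (E : Fin (D + 1) → ℝ) (T : PlaneTree D) : ℝ := (T.degrees.map E).sum

/-- The maximal distance of a vertex to the root (`0` for the one-vertex tree). -/
def height : PlaneTree D → ℕ
  | node _ c => Finset.univ.sup fun i => (c i).height + 1

/-- The neighbourhood of the root of radius `n`: the subtree that is spanned by the vertices of
height at most `n`. -/
def trunc : ℕ → PlaneTree D → PlaneTree D
  | 0, _ => node 0 Fin.elim0
  | n + 1, node k c => node k fun i => (c i).trunc n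

theorem height_trunc (n : ℕ) (T : PlaneTree D) : (T.trunc n).height = min n T.height := by
  induction n generalizing T with
  | zero => simp [trunc, height]
  | succ n ih =>
    cases T with
    | node k c =>
      simp only [trunc, height, ih]
      apply le_antisymm
      · refine Finset.sup_le fun i hi => le_min (by omega) ?_
        exact le_trans (by omega) (Finset.le_sup (f := fun i => (c i).height + 1) hi)
      · rcases (Finset.univ : Finset (Fin (k : ℕ))).eq_empty_or_nonempty with h | h
        · simp [h]
        · obtain ⟨i, hi, h2⟩ := Finset.exists_mem_eq_sup _ h fun i => (c i).height + 1
          rw [h2]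
          exact le_trans (by omega)
            (Finset.le_sup (f := fun i => min n (c i).height + 1) hi)

theorem height_lt_order (T : PlaneTree D) : T.height < T.order := by
  induction T with
  | node k c ih =>
    simp only [height, order, degrees, Multiset.card_cons, Multiset.card_sum, Nat.lt_succ_iff]
    refine Finset.sup_le fun i hi => le_trans (ih i) ?_
    exact Finset.single_le_sum (f := fun i => (c i).order) (fun _ _ => Nat.zero_le _) hi

theorem finite_height_lt (n : ℕ) : {T : PlaneTree D | T.height < n}.Finite := by
  induction n with
  | zero => simp
  | succ n ih =>
    have : Finite {T : PlaneTree D | T.height < n} := ih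
    refine (Set.finite_range fun p : (k : Fin (D + 1)) × (Fin (k : ℕ) →
      {T : PlaneTree D | T.height < n}) => node p.1 fun i => (p.2 i).1).subset ?_
    rintro ⟨k, c⟩ hT
    refine ⟨⟨k, fun i => ⟨c i, ?_⟩⟩, rfl⟩
    have h := Finset.le_sup (f := fun i => (c i).height + 1) (Finset.mem_univ i)
    simp only [Set.mem_ofPred_eq, height] at hT ⊢
    omega

instance : MeasurableSpace (PlaneTree D) := ⊤

end PlaneTree

/-- The plane trees on `N` vertices with branching numbers at most `D`. -/
abbrev TreesOfOrder (D N : ℕ) : Type := {T : PlaneTree D // T.order = N}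

/-- The plane trees of height exactly `n` with branching numbers at most `D`. -/
abbrev TreesOfHeight (D n : ℕ) : Type := {T : PlaneTree D // T.height = n}

instance (D N : ℕ) : Finite (TreesOfOrder D N) :=
  ((PlaneTree.finite_height_lt N).subset fun T (hT : T.order = N) =>
    hT ▸ T.height_lt_order).to_subtype

instance (D n : ℕ) : Finite (TreesOfHeight D n) :=
  ((PlaneTree.finite_height_lt (n + 1)).subset fun T (hT : T.height = n) =>
    Nat.lt_succ_iff.2 hT.le).to_subtype

instance (D N : ℕ) : Fintype (TreesOfOrder D N) := Fintype.ofFinite _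

instance (D n : ℕ) : Fintype (TreesOfHeight D n) := Fintype.ofFinite _

/-- The truncation map from the trees of height `n + 1` to the trees of height `n`. -/
def truncHeight {D : ℕ} (n : ℕ) (T : TreesOfHeight D (n + 1)) : TreesOfHeight D n :=
  ⟨T.1.trunc n, by rw [PlaneTree.height_trunc, T.2]; omega⟩

variable {D : ℕ}

/-- The partition function. -/
def partitionFunction (E : Fin (D + 1) → ℝ) (β : ℝ) (N : ℕ) : ℝ :=
  ∑ T : TreesOfOrder D N, Real.exp (-β * T.1.energy E)

/-- The Gibbs measure on the trees with `N` vertices. -/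
def gibbsMeasure (E : Fin (D + 1) → ℝ) (β : ℝ) (N : ℕ) : Measure (TreesOfOrder D N) :=
  ∑ T : TreesOfOrder D N,
    ENNReal.ofReal (Real.exp (-β * T.1.energy E) / partitionFunction E β N) • Measure.dirac T

/-- The image of the Gibbs measure on the trees with `N` vertices under `T ↦ T.trunc n`, as a
measure on the trees of height `n`. Once `N` is so large that all trees with `N` vertices have
height at least `n`, nothing is lost by the restriction to the trees of height `n`. -/
def truncatedGibbsMeasure (E : Fin (D + 1) → ℝ) (β : ℝ) (n N : ℕ) :
    Measure (TreesOfHeight D n) :=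
  ((gibbsMeasure E β N).map fun T => T.1.trunc n).comap Subtype.val

/-- The total variation distance of two finite measures,
`sup |μ A - ν A|` over the measurable sets `A`. -/
def tvDist {α : Type*} [MeasurableSpace α] (μ ν : Measure α) : ℝ :=
  ⨆ A : {A : Set α // MeasurableSet A}, |μ.real A.1 - ν.real A.1|

/-- `P` is a probability measure on the trees of height `n`, and the laws of the radius-`n`
neighbourhood of the root under the Gibbs measures converge to `P` in total variation. -/
def IsLimitMeasure (E : Fin (D + 1) → ℝ) (β : ℝ) (n : ℕ) (P : Measure (TreesOfHeight D n)) :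
    Prop :=
  IsProbabilityMeasure P ∧
    Tendsto (fun N => tvDist (truncatedGibbsMeasure E β n N) P) atTop (𝓝 0)

end

/-! Write w_k = exp(-β E_k), φ(x) = ∑ w_k x^k, and let T be the generating function of the partition
functions. Splitting a tree at its root gives T = X φ(T). A tree with prescribed radius-n
neighbourhood τ arises by grafting arbitrary trees onto the vertices of τ at level n. Its class
therefore has generating function W X^a T^m, with m the number of those vertices
(`exists_treeGF_trunc_eq`), and the mass of τ under the truncated Gibbs measure is W [X^N](X^a T^m)
/ [X^N] T.

Lagrange inversion, N [X^N] T^m = m [x^(N-m)] φ^N, reduces the ratio to coefficients of large powers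
of φ. For D ≥ 2 some r > 0 makes the weights w_k r^k / φ(r) a probability vector of mean 1. All of
its entries are positive, so the local limit theorem applies: √N times the tilted coefficient tends
to a constant that does not depend on m. Hence [X^N] T^m ~ κ m r^m ρ^(-N) N^(-3/2) for m ≥ 1, with ρ
= r / φ(r), and the ratio tends to m r^(m-1) ρ^a. For D = 1 no such r exists, but there is only one
tree of each height.

The space of trees of height n is finite. Convergence of point masses is thus convergence in total
variation, no mass escapes, and the consistency relation, true for all large N, passes to the limit.
-/

noncomputable section

/-! ### Generating functions of additive statistics -/

/-- The generating function `∑ a, f a X ^ (ord a)`. -/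
def ordGF {α : Type*} (ord : α → ℕ) (f : α → ENNReal) : PowerSeries ENNReal :=
  PowerSeries.mk fun N => ∑' a, if ord a = N then f a else 0

namespace ordGF

variable {α β : Type*}

theorem comp_equiv (e : α ≃ β) (ord : β → ℕ) (f : β → ENNReal) :
    ordGF (fun a => ord (e a)) (fun a => f (e a)) = ordGF ord f := by
  ext1 N
  simp only [ordGF, PowerSeries.coeff_mk]
  exact e.tsum_eq fun b => if ord b = N then f b else 0

/-- With values in `ENNReal` the sums can be interchanged without summability conditions. Each pair
(a, b) then contributes to exactly one point of one antidiagonal, namely (ord₁ a, ord₂ b). -/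
theorem prod (ord₁ : α → ℕ) (ord₂ : β → ℕ) (f : α → ENNReal) (g : β → ENNReal) :
    ordGF (fun x : α × β => ord₁ x.1 + ord₂ x.2) (fun x => f x.1 * g x.2) =
      ordGF ord₁ f * ordGF ord₂ g := by
  ext1 N
  simp only [ordGF, PowerSeries.coeff_mk, PowerSeries.coeff_mul]
  simp only [← ENNReal.tsum_mul_left, ← ENNReal.tsum_mul_right]
  simp only [← Summable.tsum_finsetSum (L := SummationFilter.unconditional _)
    fun _ _ => ENNReal.summable]
  rw [ENNReal.tsum_prod', ENNReal.tsum_comm]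
  refine tsum_congr fun b => tsum_congr fun a => ?_
  simp only [ite_mul, mul_ite, zero_mul, mul_zero]
  rw [← Finset.sum_filter, Finset.sum_filter]
  by_cases h : ord₁ a + ord₂ b = N
  · rw [if_pos h, Finset.sum_eq_single (ord₁ a, ord₂ b)]
    · simp
    · rintro ⟨i, j⟩ _ hne
      simp only [ite_eq_right_iff]
      rintro rfl rfl
      exact absurd rfl hne
    · intro h'; simp [h] at h'
  · rw [if_neg h, Finset.sum_eq_zero]
    rintro ⟨i, j⟩ hij
    simp only [ite_eq_right_iff]
    rintro rfl rfl
    exact absurd (Finset.HasAntidiagonal.mem_antidiagonal.1 hij) h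

theorem pi (ord : α → ℕ) (k : ℕ) (f : Fin k → α → ENNReal) :
    ordGF (fun c : Fin k → α => ∑ i, ord (c i)) (fun c => ∏ i, f i (c i)) =
      ∏ i, ordGF ord (f i) := by
  induction k with
  | zero =>
    ext1 N
    simp [ordGF, PowerSeries.coeff_one, eq_comm]
  | succ k ih =>
    rw [Fin.prod_univ_succ, ← ih, ← prod,
      ← comp_equiv (Fin.consEquiv fun _ : Fin (k + 1) => α)]
    simp [Fin.consEquiv, Fin.sum_univ_succ, Fin.prod_univ_succ]

theorem sigma {ι : Type*} [Fintype ι] {γ : ι → Type*} (ord : (Σ i, γ i) → ℕ)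
    (f : (Σ i, γ i) → ENNReal) :
    ordGF ord f = ∑ i, ordGF (fun c => ord ⟨i, c⟩) (fun c => f ⟨i, c⟩) := by
  ext1 N
  simp only [ordGF, PowerSeries.coeff_mk, map_sum]
  rw [ENNReal.tsum_sigma', tsum_fintype]

theorem succ_mul (ord : α → ℕ) (c : ENNReal) (f : α → ENNReal) :
    ordGF (fun a => ord a + 1) (fun a => c * f a) =
      PowerSeries.X * (PowerSeries.C c * ordGF ord f) := by
  ext1 N
  cases N with
  | zero => simp [ordGF]
  | succ N => simp [ordGF, PowerSeries.coeff_succ_X_mul, ← ENNReal.tsum_mul_left]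

end ordGF

/-! ### Generating functions of weighted trees -/

namespace PlaneTree

variable {D : ℕ}

/-- The root's branching number and the subtrees at its children. -/
def equivSigma : PlaneTree D ≃ Σ k : Fin (D + 1), (Fin (k : ℕ) → PlaneTree D) where
  toFun | node k c => ⟨k, c⟩
  invFun x := node x.1 x.2
  left_inv | node _ _ => rfl
  right_inv _ := rfl

theorem order_node (k : Fin (D + 1)) (c : Fin (k : ℕ) → PlaneTree D) :
    (node k c).order = ∑ i, (c i).order + 1 := by
  simp [order, degrees]

/-- The product over the vertices of the weights of their branching numbers. -/
def weight (w : Fin (D + 1) → NNReal) (T : PlaneTree D) : NNReal := (T.degrees.map w).prod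

theorem weight_node (w : Fin (D + 1) → NNReal) (k : Fin (D + 1))
    (c : Fin (k : ℕ) → PlaneTree D) :
    (node k c).weight w = w k * ∏ i, (c i).weight w := by
  rw [weight, degrees, Multiset.map_cons, Multiset.prod_cons]
  congr 1
  have := map_sum (Multiset.mapAddMonoidHom w) (fun i => (c i).degrees) Finset.univ
  simp only [Multiset.coe_mapAddMonoidHom] at this
  rw [this, Multiset.prod_sum]
  rfl

theorem ordGF_order (f : PlaneTree D → ENNReal) :
    ordGF order f = ∑ k : Fin (D + 1), ordGF
      (fun c : Fin (k : ℕ) → PlaneTree D => ∑ i, (c i).order + 1) (fun c => f (node k c)) := by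
  rw [← ordGF.comp_equiv equivSigma.symm, ordGF.sigma]
  simp only [equivSigma, Equiv.coe_fn_symm_mk, order_node]

/-- The generating function of the weights of the trees in `S`. -/
def treeGF (w : Fin (D + 1) → NNReal) (S : Set (PlaneTree D)) : PowerSeries ENNReal :=
  ordGF order (S.indicator fun T => (T.weight w : ENNReal))

/-- Splitting at the root: X counts the root, w k is its weight, and the k subtrees are chosen
independently. -/
theorem treeGF_univ (w : Fin (D + 1) → NNReal) :
    treeGF w Set.univ = PowerSeries.X * ∑ k : Fin (D + 1),
      PowerSeries.C (w k : ENNReal) * treeGF w Set.univ ^ (k : ℕ) := by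
  conv_lhs => rw [treeGF, ordGF_order]
  rw [Finset.mul_sum]
  refine Finset.sum_congr rfl fun k _ => ?_
  simp only [Set.indicator_univ, weight_node, ENNReal.coe_mul, treeGF, ENNReal.ofNNReal_finsetProd]
  rw [ordGF.succ_mul (fun c : Fin (k : ℕ) → PlaneTree D => ∑ i, (c i).order),
    ordGF.pi order (k : ℕ) fun _ T => (T.weight w : ENNReal)]
  simp

theorem trunc_succ_eq_node_iff {n : ℕ} {k : Fin (D + 1)} {c c' : Fin (k : ℕ) → PlaneTree D} :
    (node k c').trunc (n + 1) = node k c ↔ ∀ i, (c' i).trunc n = c i := by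
  simp [trunc, funext_iff]

/-- The trees with given neighbourhood of the root of radius `n` are obtained by grafting
arbitrary trees onto the vertices at distance `n`. -/
theorem exists_treeGF_trunc_eq (w : Fin (D + 1) → NNReal) (n : ℕ) (τ : PlaneTree D) :
    ∃ (W : NNReal) (a m : ℕ), treeGF w {T | T.trunc n = τ} =
      PowerSeries.C (W : ENNReal) * (PowerSeries.X ^ a * treeGF w Set.univ ^ m) := by
  induction n generalizing τ with
  | zero =>
    by_cases h : node 0 Fin.elim0 = τ
    -- For an attained τ, a counts the vertices strictly below level n, W is the product of their
    -- weights, and m counts the vertices at level n, whose weights belong to the grafted trees.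
    -- Unattained τ get W = 0.
    · refine ⟨1, 0, 1, ?_⟩
      have : {T : PlaneTree D | T.trunc 0 = τ} = Set.univ := by
        ext T; simp [trunc, h]
      simp [this]
    · refine ⟨0, 0, 0, ?_⟩
      have : {T : PlaneTree D | T.trunc 0 = τ} = ∅ := by
        ext T; simp [trunc, h]
      ext1 N
      simp [this, treeGF, ordGF]
  | succ n ih =>
    obtain ⟨k, c⟩ := τ
    choose W a m h using fun i => ih (c i)
    refine ⟨w k * ∏ i, W i, ∑ i, a i + 1, ∑ i, m i, ?_⟩
    rw [treeGF, ordGF_order, Finset.sum_eq_single k]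
    · have : ∀ c' : Fin (k : ℕ) → PlaneTree D,
          {T | T.trunc (n + 1) = node k c}.indicator (fun T => (T.weight w : ENNReal)) (node k c') =
          w k * ∏ i, {T | T.trunc n = c i}.indicator (fun T => (T.weight w : ENNReal)) (c' i) := by
        intro c'
        by_cases hc : ∀ i, (c' i).trunc n = c i
        · rw [Set.indicator_of_mem (by exact trunc_succ_eq_node_iff.2 hc), weight_node]
          push_cast
          congr 1
          exact Finset.prod_congr rfl fun i _ =>
            (Set.indicator_of_mem (s := {T : PlaneTree D | T.trunc n = c i}) (hc i)
              fun T => (T.weight w : ENNReal)).symm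
        · rw [Set.indicator_of_notMem (by exact fun h => hc (trunc_succ_eq_node_iff.1 h))]
          obtain ⟨i, hi⟩ := not_forall.1 hc
          rw [Finset.prod_eq_zero (Finset.mem_univ i)
            (Set.indicator_of_notMem (s := {T : PlaneTree D | T.trunc n = c i}) hi _), mul_zero]
      simp only [this]
      rw [ordGF.succ_mul (fun c : Fin (k : ℕ) → PlaneTree D => ∑ i, (c i).order), ordGF.pi]
      have h' : ∀ i, ordGF order ({T : PlaneTree D | T.trunc n = c i}.indicator
          fun T => (T.weight w : ENNReal)) = _ := h
      simp only [h', Finset.prod_mul_distrib, Finset.prod_pow_eq_pow_sum, ENNReal.coe_mul,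
        ENNReal.ofNNReal_finsetProd, map_mul, map_prod, pow_succ]
      ring
    · intro k' _ hk
      ext1 N
      have : ∀ c' : Fin (k' : ℕ) → PlaneTree D,
          {T | T.trunc (n + 1) = node k c}.indicator (fun T => (T.weight w : ENNReal))
            (node k' c') = 0 := by
        intro c'
        refine Set.indicator_of_notMem ?_ _
        simp only [Set.mem_ofPred_eq, trunc]
        intro h
        exact hk (node.inj h).1
      simp [ordGF, this]
    · simp

/-- The total weight of the trees with `N` vertices in `S`. -/
def orderWeight (w : Fin (D + 1) → NNReal) (S : Set (PlaneTree D)) (N : ℕ) : NNReal :=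
  ∑ T : TreesOfOrder D N, S.indicator (weight w) T.1

/-- Only finitely many trees have a given order, so all coefficients are finite. Identities proved
in `ENNReal` thus descend to `NNReal` by injectivity and then map to `ℝ`. -/
theorem treeGF_eq_map (w : Fin (D + 1) → NNReal) (S : Set (PlaneTree D)) :
    treeGF w S = PowerSeries.map ENNReal.ofNNRealHom (PowerSeries.mk (orderWeight w S)) := by
  ext1 N
  simp only [treeGF, ordGF, PowerSeries.coeff_mk, PowerSeries.coeff_map, orderWeight, map_sum]
  rw [← tsum_fintype (L := SummationFilter.unconditional _)]
  refine Eq.trans ?_ ((tsum_subtype {T : PlaneTree D | T.order = N}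
    (fun T => S.indicator (fun T => (T.weight w : ENNReal)) T)).symm.trans (tsum_congr fun T => ?_))
  · refine tsum_congr fun T => ?_
    rw [Set.indicator_apply (s := {T : PlaneTree D | T.order = N})]
    rfl
  · by_cases h : T.1 ∈ S
    · simp [Set.indicator_of_mem h]
    · simp [Set.indicator_of_notMem h]
      rfl

/-- The generating function of the partition functions. -/
def partitionGF (w : Fin (D + 1) → NNReal) : PowerSeries ℝ :=
  PowerSeries.mk fun N => (orderWeight w Set.univ N : ℝ)

theorem partitionGF_eq_map (w : Fin (D + 1) → NNReal) :
    partitionGF w = PowerSeries.map NNReal.toRealHom (PowerSeries.mk (orderWeight w Set.univ)) := by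
  ext1 N
  simp [partitionGF]

theorem partitionGF_eq (w : Fin (D + 1) → NNReal) :
    partitionGF w = PowerSeries.X * ∑ k : Fin (D + 1),
      PowerSeries.C (w k : ℝ) * partitionGF w ^ (k : ℕ) := by
  have h : (PowerSeries.mk (orderWeight w Set.univ)) = PowerSeries.X * ∑ k : Fin (D + 1),
      PowerSeries.C (w k) * (PowerSeries.mk (orderWeight w Set.univ)) ^ (k : ℕ) := by
    apply PowerSeries.map_injective ENNReal.ofNNRealHom ENNReal.coe_injective
    rw [← treeGF_eq_map]
    simp only [map_mul, map_sum, map_pow, PowerSeries.map_X, PowerSeries.map_C, ← treeGF_eq_map]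
    exact treeGF_univ w
  have h2 := congrArg (PowerSeries.map NNReal.toRealHom) h
  simp only [map_mul, map_sum, map_pow, PowerSeries.map_X, PowerSeries.map_C,
    ← partitionGF_eq_map] at h2
  exact h2

theorem exists_orderWeight_trunc_eq (w : Fin (D + 1) → NNReal) (n : ℕ) (τ : PlaneTree D) :
    ∃ (W : ℝ) (a m : ℕ), ∀ N, (orderWeight w {T | T.trunc n = τ} N : ℝ) =
      W * PowerSeries.coeff N (PowerSeries.X ^ a * partitionGF w ^ m) := by
  obtain ⟨W, a, m, h⟩ := exists_treeGF_trunc_eq w n τ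
  refine ⟨W, a, m, fun N => ?_⟩
  have h1 : (PowerSeries.mk (orderWeight w {T | T.trunc n = τ})) =
      PowerSeries.C W * (PowerSeries.X ^ a * (PowerSeries.mk (orderWeight w Set.univ)) ^ m) := by
    apply PowerSeries.map_injective ENNReal.ofNNRealHom ENNReal.coe_injective
    rw [← treeGF_eq_map, h]
    simp only [map_mul, map_pow, PowerSeries.map_X, PowerSeries.map_C, ← treeGF_eq_map]
    rfl
  have h2 := congrArg (PowerSeries.map NNReal.toRealHom) h1
  simp only [map_mul, map_pow, PowerSeries.map_X, PowerSeries.map_C,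
    ← partitionGF_eq_map] at h2
  have h3 := congrArg (PowerSeries.coeff N) h2
  rw [PowerSeries.coeff_map, PowerSeries.coeff_mk, PowerSeries.coeff_C_mul] at h3
  exact h3

end PlaneTree
end

/-! ### The local limit theorem by Fourier inversion -/

noncomputable section

namespace LocalLimit

variable {D : ℕ}

/-- The polynomial `∑ k, p k X ^ k`. -/
def genPoly (p : Fin (D + 1) → ℝ) : Polynomial ℝ :=
  ∑ k : Fin (D + 1), Polynomial.monomial (k : ℕ) (p k)

/-- The characteristic function of the steps `k - 1`, taken with weights `p k`. -/
def stepChar (p : Fin (D + 1) → ℝ) (θ : ℝ) : ℂ :=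
  ∑ k, (p k : ℂ) * Complex.exp ((((k : ℕ) - 1 : ℝ) * θ : ℝ) * Complex.I)

theorem continuous_stepChar (p : Fin (D + 1) → ℝ) : Continuous (stepChar p) := by
  unfold stepChar; fun_prop

theorem eval_genPoly (p : Fin (D + 1) → ℝ) (θ : ℝ) :
    ((genPoly p).map (algebraMap ℝ ℂ)).eval (Complex.exp (θ * Complex.I)) =
      Complex.exp (θ * Complex.I) * stepChar p θ := by
  simp only [genPoly, stepChar, Polynomial.map_sum, Polynomial.map_monomial,
    Polynomial.eval_finsetSum, Polynomial.eval_monomial, Finset.mul_sum]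
  refine Finset.sum_congr rfl fun k _ => ?_
  rw [← Complex.exp_nat_mul, mul_left_comm (Complex.exp _), ← Complex.exp_add]
  congr 2
  push_cast; ring

theorem coeff_eq_intervalIntegral (q : Polynomial ℂ) (n : ℕ) :
    q.coeff n = (1 / (2 * Real.pi) : ℝ) • ∫ θ in (-Real.pi)..Real.pi,
      Complex.exp (-(n * θ * Complex.I)) * q.eval (Complex.exp (θ * Complex.I)) := by
  have : Fact (0 < 2 * Real.pi) := ⟨Real.two_pi_pos⟩
  rw [← Polynomial.fourierCoeff_toAddCircle_natCast, fourierCoeff_eq_intervalIntegral _ _ (-Real.pi)]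
  congr 1
  rw [show -Real.pi + 2 * Real.pi = Real.pi by ring]
  refine intervalIntegral.integral_congr fun θ _ => ?_
  simp only [smul_eq_mul]
  congr 1
  · rw [fourier_coe_apply]
    congr 1
    have : (Real.pi : ℂ) ≠ 0 := by exact_mod_cast Real.pi_ne_zero
    push_cast
    field_simp
  · simp [Polynomial.toAddCircle, Polynomial.aeval_continuousMap_apply,
      AddCircle.toCircle_apply_mk]

/-- Centring the steps at k - 1 cancels the factor exp(-iNθ). The remaining phase exp(imθ) does not
depend on N and disappears under the scaling θ = t / √N. -/
theorem coeff_genPoly_pow (p : Fin (D + 1) → ℝ) {m N : ℕ} (h : m ≤ N) :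
    ((((genPoly p) ^ N).coeff (N - m) : ℝ) : ℂ) =
      (1 / (2 * Real.pi) : ℝ) • ∫ θ in (-Real.pi)..Real.pi,
        Complex.exp (m * θ * Complex.I) * stepChar p θ ^ N := by
  have := coeff_eq_intervalIntegral (((genPoly p) ^ N).map (algebraMap ℝ ℂ)) (N - m)
  rw [Polynomial.coeff_map] at this
  refine this.trans ?_
  congr 1
  refine intervalIntegral.integral_congr fun θ _ => ?_
  simp only [Polynomial.map_pow, Polynomial.eval_pow, eval_genPoly, mul_pow]
  rw [← mul_assoc, ← Complex.exp_nat_mul, ← Complex.exp_add]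
  congr 2
  push_cast [h]; ring

/-- The atoms at 0 and 1 are adjacent, which excludes periodicity: these two alone make the norm
drop, and the others are bounded by the triangle inequality. -/
theorem norm_stepChar_le (p : Fin (D + 1) → ℝ) (hp : ∀ k, 0 < p k) (h1 : ∑ k, p k = 1)
    (hD : 1 ≤ D) : ∃ c > 0, ∀ θ : ℝ, |θ| ≤ Real.pi → ‖stepChar p θ‖ ≤ Real.exp (-c * θ ^ 2) := by
  obtain ⟨d, rfl⟩ : ∃ d, D = d + 1 := ⟨D - 1, by omega⟩
  set a := p 0
  set b := p 1
  have ha : 0 < a := hp 0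
  have hb : 0 < b := hp 1
  have hsum : ∀ f : Fin (d + 1 + 1) → ℝ, ∑ k, f k = f 0 + f 1 + ∑ k : Fin d, f k.succ.succ := by
    intro f; rw [Fin.sum_univ_succ, Fin.sum_univ_succ, ← add_assoc]; rfl
  have hsumc : ∀ f : Fin (d + 1 + 1) → ℂ, ∑ k, f k = f 0 + f 1 + ∑ k : Fin d, f k.succ.succ := by
    intro f; rw [Fin.sum_univ_succ, Fin.sum_univ_succ, ← add_assoc]; rfl
  -- With x = ab(1 - cos θ)/(a + b), the squared norm of the two-atom part is (a + b)² - 2ab(1 - cos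
  -- θ) ≤ (a + b - x)². The factor 2/π² comes from 1 - cos θ ≥ 2θ²/π² on [-π, π].
  refine ⟨a * b / (a + b) * (2 / Real.pi ^ 2), by positivity, fun θ hθ => ?_⟩
  have hcos := Real.cos_le_one_sub_mul_cos_sq hθ
  have key : ‖(a : ℂ) * Complex.exp ((-θ : ℝ) * Complex.I) + b‖ ≤
      a + b - a * b / (a + b) * (1 - Real.cos θ) := by
    have hc1 := Real.cos_le_one θ
    have hc2 := Real.neg_one_le_cos θ
    have hab : a * b / (a + b) * (1 - Real.cos θ) ≤ a + b := by
      rw [div_mul_eq_mul_div, div_le_iff₀ (by positivity)]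
      nlinarith [mul_pos ha hb]
    refine abs_le_of_sq_le_sq' ?_ (by linarith) |>.2
    rw [← Complex.normSq_eq_norm_sq, Complex.normSq_apply]
    have e1 : ((a : ℂ) * Complex.exp ((-θ : ℝ) * Complex.I) + b).re = a * Real.cos θ + b := by
      simp [Complex.exp_re, Complex.exp_im]
    have e2 : ((a : ℂ) * Complex.exp ((-θ : ℝ) * Complex.I) + b).im = -(a * Real.sin θ) := by
      simp [Complex.exp_re, Complex.exp_im]
    rw [e1, e2]
    have hs := Real.sin_sq_add_cos_sq θ
    have : (a + b) * (a * b / (a + b) * (1 - Real.cos θ)) = a * b * (1 - Real.cos θ) := by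
      field_simp
    generalize a * b / (a + b) * (1 - Real.cos θ) = x at this ⊢
    have e3 : a ^ 2 * Real.sin θ ^ 2 = a ^ 2 - a ^ 2 * Real.cos θ ^ 2 := by
      rw [← eq_sub_iff_add_eq] at hs
      rw [hs]; ring
    nlinarith [sq_nonneg x]
  calc ‖stepChar p θ‖ ≤ ‖(a : ℂ) * Complex.exp ((-θ : ℝ) * Complex.I) + b‖ +
        ∑ k : Fin d, p k.succ.succ := by
        rw [stepChar, hsumc]
        refine (norm_add_le _ _).trans (add_le_add (le_of_eq ?_) ?_)
        · simp [a, b]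
        · refine (norm_sum_le _ _).trans (Finset.sum_le_sum fun k _ => ?_)
          rw [norm_mul, Complex.norm_exp_ofReal_mul_I, mul_one, Complex.norm_real,
            Real.norm_of_nonneg (hp _).le]
    _ ≤ 1 - a * b / (a + b) * (1 - Real.cos θ) := by
        rw [hsum] at h1; linarith
    _ ≤ 1 - a * b / (a + b) * (2 / Real.pi ^ 2) * θ ^ 2 := by
        rw [mul_assoc]
        gcongr
        linarith
    _ ≤ _ := by
        have := Real.add_one_le_exp (-(a * b / (a + b) * (2 / Real.pi ^ 2)) * θ ^ 2)
        linarith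

/-- The central limit theorem for characteristic functions: expand each atom to second order and use
(1 + z_N)^N → exp z when N z_N → z. -/
theorem tendsto_stepChar_pow (p : Fin (D + 1) → ℝ) (h1 : ∑ k, p k = 1)
    (hmean : ∑ k, p k * ((k : ℕ) - 1 : ℝ) = 0) (t : ℝ) :
    Tendsto (fun N : ℕ => stepChar p (t / √N) ^ N) atTop
      (𝓝 (Complex.exp ((-((∑ k, p k * ((k : ℕ) - 1 : ℝ) ^ 2) / 2) * t ^ 2 : ℝ)))) := by
  have hlim : ∀ x : ℝ, Tendsto (fun N : ℕ => (N : ℂ) * (Complex.exp ((x * (t / √N) : ℝ) * Complex.I)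
      - 1 - (x * (t / √N) : ℝ) * Complex.I)) atTop (𝓝 ((-(x ^ 2 / 2) * t ^ 2 : ℝ))) := by
    intro x
    have h0 : Tendsto (fun N : ℕ => ((x * (t / √N) : ℝ) * Complex.I : ℂ)) atTop (𝓝 0) := by
      have : Tendsto (fun N : ℕ => x * (t / √N)) atTop (𝓝 (x * 0)) :=
        ((tendsto_const_nhds).div_atTop
          (Real.tendsto_sqrt_atTop.comp tendsto_natCast_atTop_atTop)).const_mul x
      have h2 := (Complex.continuous_ofReal.tendsto _).comp this
      simpa using h2.mul_const Complex.I
    have ho := (Complex.exp_sub_sum_range_succ_isLittleO_pow 2).comp_tendsto h0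
    have ho2 : (fun N : ℕ => Complex.exp ((x * (t / √N) : ℝ) * Complex.I) -
        (1 + (x * (t / √N) : ℝ) * Complex.I + ((x * (t / √N) : ℝ) * Complex.I) ^ 2 / 2))
        =o[atTop] fun N : ℕ => ((N : ℂ))⁻¹ := by
      refine (ho.congr_left fun N => ?_).trans_isBigO ?_
      · simp [Finset.sum_range_succ]
      · refine Asymptotics.IsBigO.of_bound ((x * t) ^ 2) (Eventually.of_forall fun N => ?_)
        simp only [Function.comp, norm_pow, norm_mul, Complex.norm_I, Complex.norm_real,
          norm_inv, Complex.norm_natCast, Real.norm_eq_abs, mul_pow, sq_abs, div_pow,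
          Real.sq_sqrt (Nat.cast_nonneg N)]
        apply le_of_eq; ring
    have ht := ho2.tendsto_inv_smul_nhds_zero
    have := ht.add_const ((-(x ^ 2 / 2) * t ^ 2 : ℝ) : ℂ)
    rw [zero_add] at this
    refine this.congr' ?_
    filter_upwards [eventually_gt_atTop 0] with N hN
    have hN' : (0 : ℝ) < N := by exact_mod_cast hN
    have e : (N : ℂ) * (((x * (t / √N) : ℝ) : ℂ) * Complex.I) ^ 2 = -((x ^ 2 * t ^ 2 : ℝ) : ℂ) := by
      rw [mul_pow, Complex.I_sq, mul_neg_one, mul_neg, ← Complex.ofReal_pow, mul_pow, div_pow,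
        Real.sq_sqrt hN'.le, ← Complex.ofReal_natCast, ← Complex.ofReal_mul]
      congr 2
      field_simp
    simp only [inv_inv, smul_eq_mul]
    have e' : ((-(x ^ 2 / 2) * t ^ 2 : ℝ) : ℂ) = -((x ^ 2 * t ^ 2 : ℝ) : ℂ) / 2 := by
      push_cast; ring
    rw [e', ← e]; ring
  -- The constant and linear terms may be split off because the weights sum to 1 and the centred
  -- mean is 0.
  have hs : ∀ N : ℕ, stepChar p (t / √N) = 1 + ∑ k, (p k : ℂ) *
      (Complex.exp ((((k : ℕ) - 1 : ℝ) * (t / √N) : ℝ) * Complex.I)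
      - 1 - (((k : ℕ) - 1 : ℝ) * (t / √N) : ℝ) * Complex.I) := by
    intro N
    have h1' : ∑ k, (p k : ℂ) = 1 := by exact_mod_cast h1
    have h2' : ∑ k, (p k : ℂ) * ((((k : ℕ) - 1 : ℝ) * (t / √N) : ℝ) * Complex.I) = 0 := by
      have : ∑ k, (p k : ℂ) * (((k : ℕ) - 1 : ℝ) : ℂ) = 0 := by exact_mod_cast hmean
      calc _ = (∑ k, (p k : ℂ) * (((k : ℕ) - 1 : ℝ) : ℂ)) * (((t / √N : ℝ) : ℂ) * Complex.I) := by
            rw [Finset.sum_mul]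
            refine Finset.sum_congr rfl fun k _ => ?_
            push_cast; ring
        _ = 0 := by rw [this, zero_mul]
    simp only [mul_sub, mul_one, Finset.sum_sub_distrib, h1', h2', stepChar]
    ring
  simp only [hs]
  refine Complex.tendsto_one_add_pow_exp_of_tendsto ?_
  have := tendsto_finsetSum Finset.univ fun (k : Fin (D + 1)) _ =>
    (hlim ((k : ℕ) - 1 : ℝ)).const_mul (p k : ℂ)
  convert! this using 2
  · rw [Finset.mul_sum]
    exact Finset.sum_congr rfl fun k _ => by ring
  · simp only [← Complex.ofReal_mul, ← Complex.ofReal_sum]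
    congr 1
    rw [neg_mul, Finset.sum_div, Finset.sum_mul, ← Finset.sum_neg_distrib]
    exact Finset.sum_congr rfl fun k _ => by ring

/-- The local limit theorem near the mean, for a probability vector `p` on `{0, …, D}` with
mean `1`. -/
theorem tendsto_sqrt_mul_coeff_genPoly_pow (p : Fin (D + 1) → ℝ) (hp : ∀ k, 0 < p k)
    (h1 : ∑ k, p k = 1) (hmean : ∑ k, p k * ((k : ℕ) - 1 : ℝ) = 0) (hD : 1 ≤ D) :
    ∃ κ > 0, ∀ m : ℕ,
      Tendsto (fun N : ℕ => √N * ((genPoly p) ^ N).coeff (N - m)) atTop (𝓝 κ) := by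
  obtain ⟨c, hc, hbound⟩ := norm_stepChar_le p hp h1 hD
  set v := (∑ k, p k * ((k : ℕ) - 1 : ℝ) ^ 2) / 2 with hv
  have hvpos : 0 < v := by
    refine half_pos (Finset.sum_pos' (fun k _ => mul_nonneg (hp k).le (sq_nonneg _))
      ⟨0, Finset.mem_univ _, ?_⟩)
    simpa using hp 0
  -- This is (1/2π) ∫ exp(-v t²) dt, where v is half the variance.
  refine ⟨1 / (2 * Real.pi) * √(Real.pi / v), by positivity, fun m => ?_⟩
  suffices h : Tendsto (fun N : ℕ => ((√N * ((genPoly p) ^ N).coeff (N - m) : ℝ) : ℂ)) atTop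
      (𝓝 ((1 / (2 * Real.pi) * √(Real.pi / v) : ℝ) : ℂ)) by
    exact (Complex.continuous_re.tendsto _).comp h
  -- The integrand after substituting θ = t / √N, extended by 0 to the whole line, so that exp(-c
  -- t²) dominates it for every N > 0.
  let F : ℕ → ℝ → ℂ := fun N t => (Set.Ioc (-Real.pi * √N) (Real.pi * √N)).indicator
    (fun t => Complex.exp (m * (t / √N : ℝ) * Complex.I) * stepChar p (t / √N) ^ N) t
  have hF : Tendsto (fun N => ∫ t, F N t) atTop (𝓝 (∫ t : ℝ, Complex.exp ((-v * t ^ 2 : ℝ)))) := by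
    refine tendsto_integral_filter_of_dominated_convergence (fun t => Real.exp (-c * t ^ 2))
      (Eventually.of_forall fun N => ?_) ?_ (integrable_exp_neg_mul_sq hc)
      (Eventually.of_forall fun t => ?_)
    · refine (Continuous.aestronglyMeasurable ?_).indicator measurableSet_Ioc
      have := continuous_stepChar p
      fun_prop
    · filter_upwards [eventually_gt_atTop 0] with N hN
      have hN' : (0 : ℝ) < N := by exact_mod_cast hN
      have hsN : 0 < √(N : ℝ) := Real.sqrt_pos.2 hN'
      refine Eventually.of_forall fun t => ?_
      by_cases ht : t ∈ Set.Ioc (-Real.pi * √N) (Real.pi * √N)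
      · simp only [F, Set.indicator_of_mem ht]
        have habs : |t / √N| ≤ Real.pi := by
          rw [abs_le, le_div_iff₀ hsN, div_le_iff₀ hsN]
          exact ⟨ht.1.le, ht.2⟩
        rw [norm_mul, norm_pow, ← Complex.ofReal_natCast, ← Complex.ofReal_mul,
          Complex.norm_exp_ofReal_mul_I, one_mul]
        refine (pow_le_pow_left₀ (norm_nonneg _) (hbound _ habs) N).trans (le_of_eq ?_)
        rw [← Real.exp_nat_mul, div_pow, Real.sq_sqrt hN'.le]
        congr 1
        field_simp
      · simp only [F, Set.indicator_of_notMem ht, norm_zero]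
        positivity
    · have hsq : Tendsto (fun N : ℕ => √(N : ℝ)) atTop atTop :=
        Real.tendsto_sqrt_atTop.comp tendsto_natCast_atTop_atTop
      have hlim : Tendsto (fun N : ℕ => Complex.exp (m * (t / √N : ℝ) * Complex.I) *
          stepChar p (t / √N) ^ N) atTop (𝓝 (Complex.exp ((-v * t ^ 2 : ℝ)))) := by
        have h0 : Tendsto (fun N : ℕ => Complex.exp (m * (t / √N : ℝ) * Complex.I)) atTop (𝓝 1) := by
          have h0 : Tendsto (fun N : ℕ => t / √N) atTop (𝓝 0) := tendsto_const_nhds.div_atTop hsq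
          have hcont : Continuous fun x : ℝ => Complex.exp (m * (x : ℝ) * Complex.I) := by fun_prop
          simpa only [Function.comp_def, Complex.ofReal_zero, mul_zero, zero_mul,
            Complex.exp_zero] using (hcont.tendsto 0).comp h0
        have := h0.mul (tendsto_stepChar_pow p h1 hmean t)
        rwa [one_mul] at this
      refine hlim.congr' ?_
      filter_upwards [hsq.eventually_gt_atTop (|t| / Real.pi)] with N hN
      rw [div_lt_iff₀ Real.pi_pos, abs_lt] at hN
      have : t ∈ Set.Ioc (-Real.pi * √N) (Real.pi * √N) := ⟨by linarith, by linarith⟩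
      simp only [F, Set.indicator_of_mem this]
  have hG : ∫ t : ℝ, Complex.exp ((-v * t ^ 2 : ℝ)) = ((√(Real.pi / v) : ℝ) : ℂ) := by
    rw [← integral_gaussian v, ← integral_complex_ofReal]
    simp only [Complex.ofReal_exp]
  rw [hG] at hF
  have h2 := hF.const_mul (((1 / (2 * Real.pi) : ℝ)) : ℂ)
  rw [← Complex.ofReal_mul] at h2
  refine h2.congr' ?_
  filter_upwards [eventually_gt_atTop 0, eventually_ge_atTop m] with N hN hm
  have hN' : (0 : ℝ) < N := by exact_mod_cast hN
  have hsN : 0 < √(N : ℝ) := Real.sqrt_pos.2 hN'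
  have hle : -Real.pi * √N ≤ Real.pi * √N := by nlinarith [Real.pi_pos]
  rw [Complex.ofReal_mul]
  have := coeff_genPoly_pow p hm
  refine Eq.trans ?_ (congrArg (fun z => ((√N : ℝ) : ℂ) * z) this.symm)
  simp only [F]
  rw [integral_indicator measurableSet_Ioc, ← intervalIntegral.integral_of_le hle,
    Complex.real_smul, mul_left_comm]
  congr 1
  have h3 := intervalIntegral.integral_comp_div (a := -Real.pi * √N) (b := Real.pi * √N)
    (fun θ : ℝ => Complex.exp (m * (θ : ℝ) * Complex.I) * stepChar p θ ^ N) hsN.ne'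
  rw [mul_div_cancel_right₀ _ hsN.ne', mul_div_cancel_right₀ _ hsN.ne'] at h3
  rw [h3, Complex.real_smul]

end LocalLimit
end

/-! ### Lagrange inversion, critical tilting and coefficient asymptotics -/

noncomputable section

namespace LocalLimit

variable {D : ℕ}

theorem coeff_genPoly_mul (w : Fin (D + 1) → ℝ) (q : Polynomial ℝ) (n : ℕ) :
    (genPoly w * q).coeff n = ∑ k : Fin (D + 1), if (k : ℕ) ≤ n then w k * q.coeff (n - k) else 0 := by
  rw [genPoly, Finset.sum_mul, Polynomial.finsetSum_coeff]
  refine Finset.sum_congr rfl fun k _ => ?_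
  rw [← Polynomial.C_mul_X_pow_eq_monomial, mul_assoc, Polynomial.coeff_C_mul,
    Polynomial.coeff_X_pow_mul', mul_ite, mul_zero]

theorem X_mul_derivative_genPoly (w : Fin (D + 1) → ℝ) :
    Polynomial.X * Polynomial.derivative (genPoly w) = genPoly fun k => (k : ℕ) * w k := by
  simp only [genPoly, Polynomial.derivative_sum, Finset.mul_sum]
  refine Finset.sum_congr rfl fun k _ => ?_
  rw [Polynomial.derivative_monomial]
  rcases Nat.eq_zero_or_pos (k : ℕ) with h | h
  · simp [h]
  · rw [Polynomial.X_mul_monomial, Nat.sub_add_cancel h, mul_comm]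

/-- This compares coefficients in X (φ^(N+1))' = (N+1) φ^N · X φ', and closes the induction for
Lagrange inversion. -/
theorem natCast_mul_coeff_genPoly_pow (w : Fin (D + 1) → ℝ) (N n : ℕ) :
    (n : ℝ) * ((genPoly w) ^ (N + 1)).coeff n = (N + 1) * ∑ k : Fin (D + 1),
      if (k : ℕ) ≤ n then (k : ℕ) * w k * ((genPoly w) ^ N).coeff (n - k) else 0 := by
  rw [← coeff_genPoly_mul (fun k => (k : ℕ) * w k), ← X_mul_derivative_genPoly]
  have h : (n : ℝ) * ((genPoly w) ^ (N + 1)).coeff n =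
      (Polynomial.X * Polynomial.derivative ((genPoly w) ^ (N + 1))).coeff n := by
    cases n with
    | zero => simp
    | succ n => rw [Polynomial.coeff_X_mul, Polynomial.coeff_derivative]; push_cast; ring
  rw [h, Polynomial.derivative_pow_succ, ← Polynomial.coeff_C_mul]
  refine congrArg (fun q => Polynomial.coeff q n) ?_
  rw [Polynomial.C_add, Polynomial.C_1, Polynomial.C_eq_natCast]
  ring

theorem coeff_pow_eq_zero_of_lt {T S : PowerSeries ℝ} (hT : T = PowerSeries.X * S) {N m : ℕ}
    (h : N < m) : PowerSeries.coeff N (T ^ m) = 0 := by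
  rw [hT, mul_pow, PowerSeries.coeff_X_pow_mul', if_neg (by omega)]

/-- The Lagrange inversion formula for the powers of the solution of `T = X φ(T)`. -/
theorem natCast_mul_coeff_pow (w : Fin (D + 1) → ℝ) {T : PowerSeries ℝ}
    (hT : T = PowerSeries.X * ∑ k : Fin (D + 1), PowerSeries.C (w k) * T ^ (k : ℕ)) :
    ∀ N m : ℕ, m ≤ N + 1 → ((N + 1 : ℕ) : ℝ) * PowerSeries.coeff (N + 1) (T ^ m) =
      m * ((genPoly w) ^ (N + 1)).coeff (N + 1 - m) := by
  -- Replace one factor T by X φ(T); this lowers the degree by one while raising the power, hence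
  -- the induction on N for all m at once.
  have hrec : ∀ N m : ℕ, PowerSeries.coeff (N + 1) (T ^ (m + 1)) =
      ∑ k : Fin (D + 1), w k * PowerSeries.coeff N (T ^ (m + (k : ℕ))) := by
    intro N m
    have : T ^ (m + 1) = PowerSeries.X * ∑ k : Fin (D + 1), PowerSeries.C (w k) * T ^ (m + (k : ℕ)) := by
      rw [pow_succ]
      nth_rewrite 2 [hT]
      rw [mul_left_comm, Finset.mul_sum]
      refine congrArg (PowerSeries.X * ·) ?_
      exact Finset.sum_congr rfl fun k _ => by rw [pow_add]; ring
    rw [this, PowerSeries.coeff_succ_X_mul, map_sum]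
    simp
  intro N
  induction N with
  | zero =>
    intro m hm
    interval_cases m
    · simp [PowerSeries.coeff_one]
    · have h0 := hrec 0 0
      rw [Fin.sum_univ_succ, Finset.sum_eq_zero fun k _ => by
        rw [coeff_pow_eq_zero_of_lt hT (by simp), mul_zero]] at h0
      have h1 := coeff_genPoly_mul w 1 0
      rw [Fin.sum_univ_succ, Finset.sum_eq_zero fun k _ => by simp] at h1
      simp at h0 h1
      simp [h0, h1]
  | succ N ih =>
    intro m hm
    cases m with
    | zero => simp [PowerSeries.coeff_one]
    | succ m =>
      set n := N + 1 - m with hn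
      have hn' : (n : ℝ) = N + 1 - m := by
        rw [hn, Nat.cast_sub (by omega)]; push_cast; ring
      have e : N + 1 + 1 - (m + 1) = n := by omega
      have hd := natCast_mul_coeff_genPoly_pow w (N + 1) n
      have hc : ((genPoly w) ^ (N + 1 + 1)).coeff n = _ :=
        (congrArg (fun q => Polynomial.coeff q n) (pow_succ' _ _)).trans (coeff_genPoly_mul w _ n)
      rw [e, hrec]
      -- The induction hypothesis puts m + k in front of the k-th term. The part with m reassembles
      -- φ^(N+2), and the part with k gives X φ' φ^(N+1), whose coefficient is n/(N+2) times that of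
      -- φ^(N+2). Since n = N + 1 - m, the total factor is (m+1)(N+1)/(N+2). Terms with k > n vanish
      -- as T^(m+k) starts in degree m + k.
      have hsum : ((N + 1 : ℕ) : ℝ) * ∑ k : Fin (D + 1), w k * PowerSeries.coeff (N + 1) (T ^ (m + k)) =
          (m : ℝ) * (∑ k : Fin (D + 1),
            if (k : ℕ) ≤ n then w k * ((genPoly w) ^ (N + 1)).coeff (n - k) else 0) +
          ∑ k : Fin (D + 1),
            if (k : ℕ) ≤ n then (k : ℕ) * w k * ((genPoly w) ^ (N + 1)).coeff (n - k) else 0 := by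
        rw [Finset.mul_sum, Finset.mul_sum, ← Finset.sum_add_distrib]
        refine Finset.sum_congr rfl fun k _ => ?_
        split_ifs with hk
        · have := ih (m + k) (by omega)
          rw [show N + 1 - (m + k) = n - k by omega] at this
          rw [mul_left_comm, this]
          push_cast; ring
        · rw [coeff_pow_eq_zero_of_lt hT (by omega)]; simp
      rw [← hc] at hsum
      have hN : ((N + 1 : ℕ) : ℝ) ≠ 0 := by positivity
      apply mul_left_cancel₀ hN
      rw [mul_left_comm, hsum, mul_add]
      push_cast at hd hsum ⊢
      rw [hn'] at hd
      linear_combination -hd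

/-- The sum is r φ'(r) - φ(r), which is -w 0 < 0 at r = 0; its only negative term is -w 0, and for D
≥ 2 the quadratic term outweighs it for large r. -/
theorem exists_critical_tilt (w : Fin (D + 1) → ℝ) (hw : ∀ k, 0 < w k) (hD : 2 ≤ D) :
    ∃ r > 0, ∑ k : Fin (D + 1), w k * r ^ (k : ℕ) * ((k : ℕ) - 1 : ℝ) = 0 := by
  let f : ℝ → ℝ := fun r => ∑ k : Fin (D + 1), w k * r ^ (k : ℕ) * ((k : ℕ) - 1 : ℝ)
  have hf : Continuous f := by fun_prop
  obtain ⟨d, rfl⟩ : ∃ d, D = d + 2 := ⟨D - 2, by omega⟩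
  have hfr : ∀ r, f r = -w 0 + ∑ k : Fin (d + 1), w k.succ.succ * r ^ (k + 2 : ℕ) * (k + 1 : ℝ) := by
    intro r
    simp only [f]
    rw [Fin.sum_univ_succ, Fin.sum_univ_succ]
    simp only [Fin.val_zero, Fin.val_succ, pow_zero, Nat.cast_zero]
    simp only [zero_add, Nat.cast_one, sub_self, mul_zero]
    congr 1
    · ring
    · refine Finset.sum_congr rfl fun k _ => ?_
      push_cast; ring
  have h0 : f 0 < 0 := by
    rw [hfr, Finset.sum_eq_zero fun k _ => by simp]
    linarith [hw 0]
  -- Since R ≥ 1, the quadratic term alone satisfies w_2 R² ≥ w_2 R ≥ w_0.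
  set R := 1 + w 0 / w (Fin.succ (Fin.succ (0 : Fin (d + 1)))) with hR
  have hR1 : 1 ≤ R := by
    have := div_pos (hw 0) (hw (Fin.succ (Fin.succ (0 : Fin (d + 1)))))
    linarith
  have hR2 : 0 ≤ f R := by
    rw [hfr]
    have h1 := Finset.single_le_sum (f := fun k : Fin (d + 1) =>
      w k.succ.succ * R ^ (k + 2 : ℕ) * (k + 1 : ℝ))
      (fun k _ => by have := hw k.succ.succ; positivity) (Finset.mem_univ 0)
    have h2 : w 0 ≤ w (Fin.succ (Fin.succ (0 : Fin (d + 1)))) * R := by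
      rw [hR, mul_add, mul_div_cancel₀ _ (hw _).ne']
      linarith [hw (Fin.succ (Fin.succ (0 : Fin (d + 1))))]
    have h3 : w (Fin.succ (Fin.succ (0 : Fin (d + 1)))) * R ≤
        w (Fin.succ (Fin.succ (0 : Fin (d + 1)))) * R ^ 2 :=
      mul_le_mul_of_nonneg_left (by nlinarith) (hw _).le
    simp only [Fin.val_zero, Nat.cast_zero, zero_add, mul_one] at h1
    linarith
  obtain ⟨r, hr, hr0⟩ := intermediate_value_Icc (by linarith : (0 : ℝ) ≤ R) hf.continuousOn
    ⟨h0.le, hR2⟩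
  refine ⟨r, lt_of_le_of_ne hr.1 ?_, hr0⟩
  rintro rfl
  exact h0.ne hr0

theorem coeff_genPoly_tilt (w : Fin (D + 1) → ℝ) (r c : ℝ) (N n : ℕ) :
    ((genPoly fun k => w k * r ^ (k : ℕ) * c) ^ N).coeff n =
      ((genPoly w) ^ N).coeff n * r ^ n * c ^ N := by
  have : (genPoly fun k => w k * r ^ (k : ℕ) * c) =
      Polynomial.C c * (genPoly w).comp (Polynomial.C r * Polynomial.X) := by
    simp only [genPoly, Polynomial.sum_comp, Finset.mul_sum]
    refine Finset.sum_congr rfl fun k _ => ?_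
    rw [Polynomial.monomial_comp, mul_pow, ← Polynomial.C_pow, ← mul_assoc, ← mul_assoc,
      ← Polynomial.C_mul, ← Polynomial.C_mul, Polynomial.C_mul_X_pow_eq_monomial]
    congr 1; ring
  rw [this, mul_pow, ← Polynomial.pow_comp, ← Polynomial.C_pow, Polynomial.coeff_C_mul,
    Polynomial.comp_C_mul_X_coeff]
  ring

/-- The coefficients of the powers of the solution of `T = X φ(T)` decay like
`N ^ (-3/2) ρ ^ (-N)`. -/
theorem tendsto_scaled_coeff_pow (w : Fin (D + 1) → ℝ) (hw : ∀ k, 0 < w k) (hD : 2 ≤ D)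
    {T : PowerSeries ℝ}
    (hT : T = PowerSeries.X * ∑ k : Fin (D + 1), PowerSeries.C (w k) * T ^ (k : ℕ)) :
    ∃ ρ > 0, ∃ r > 0, ∃ κ > 0, ∀ m : ℕ,
      Tendsto (fun N : ℕ => N * √N * ρ ^ N * PowerSeries.coeff N (T ^ m)) atTop
        (𝓝 (m * r ^ m * κ)) := by
  obtain ⟨r, hr, hr0⟩ := exists_critical_tilt w hw hD
  set φ := ∑ k : Fin (D + 1), w k * r ^ (k : ℕ) with hφ
  have hφ0 : 0 < φ := Finset.sum_pos (fun k _ => mul_pos (hw k) (pow_pos hr _)) Finset.univ_nonempty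
  obtain ⟨κ, hκ, hlim⟩ := tendsto_sqrt_mul_coeff_genPoly_pow (fun k => w k * r ^ (k : ℕ) * φ⁻¹)
    (fun k => by have := hw k; positivity) (by rw [← Finset.sum_mul]; exact mul_inv_cancel₀ hφ0.ne')
    (by
      rw [← zero_mul φ⁻¹, ← hr0, Finset.sum_mul]
      exact Finset.sum_congr rfl fun k _ => by ring) (by omega)
  -- Tilting multiplies the coefficient by r^(N-m) φ^(-N); the extra r^m completes this to ρ^N.
  -- Lagrange inversion accounts for the factor m and for the additional N beside √N.
  refine ⟨r * φ⁻¹, by positivity, r, hr, κ, hκ, fun m => ?_⟩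
  refine ((hlim m).const_mul (m * r ^ m)).congr' ?_
  filter_upwards [eventually_gt_atTop 0, eventually_ge_atTop m] with N hN hm
  obtain ⟨n, rfl⟩ : ∃ n, N = n + 1 := ⟨N - 1, by omega⟩
  have h := natCast_mul_coeff_pow w hT n m hm
  rw [coeff_genPoly_tilt, mul_pow r]
  have e : r ^ (n + 1) = r ^ m * r ^ (n + 1 - m) := by rw [← pow_add, Nat.add_sub_cancel' hm]
  rw [e]
  linear_combination -(√((n + 1 : ℕ) : ℝ) * (r ^ m * r ^ (n + 1 - m)) * φ⁻¹ ^ (n + 1)) * h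

theorem exists_tendsto_coeff_div (w : Fin (D + 1) → ℝ) (hw : ∀ k, 0 < w k) (hD : 2 ≤ D)
    {T : PowerSeries ℝ}
    (hT : T = PowerSeries.X * ∑ k : Fin (D + 1), PowerSeries.C (w k) * T ^ (k : ℕ)) (a m : ℕ) :
    ∃ L : ℝ, Tendsto (fun N : ℕ => PowerSeries.coeff N (PowerSeries.X ^ a * T ^ m) /
      PowerSeries.coeff N T) atTop (𝓝 L) := by
  obtain ⟨ρ, hρ, r, hr, κ, hκ, hlim⟩ := tendsto_scaled_coeff_pow w hw hD hT
  -- Working at index N + a turns the coefficient of X^a T^m into the N-th coefficient of T^m; the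
  -- mismatch with the denominator leaves ρ^a and a ratio of powers tending to 1.
  have h1 := (tendsto_add_atTop_iff_nat a).2 (hlim 1)
  simp only [pow_one, Nat.cast_one, one_mul] at h1
  have hq : Tendsto (fun N : ℕ => (((N + a : ℕ) : ℝ) / N)) atTop (𝓝 1) := by
    have : Tendsto (fun N : ℕ => 1 + (a : ℝ) / N) atTop (𝓝 (1 + 0)) :=
      (tendsto_const_nhds.div_atTop tendsto_natCast_atTop_atTop).const_add 1
    rw [add_zero] at this
    refine this.congr' ?_
    filter_upwards [eventually_gt_atTop 0] with N hN
    have : (N : ℝ) ≠ 0 := by positivity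
    push_cast
    field_simp
  have hL := (((hlim m).div h1 (by positivity)).mul (hq.mul hq.sqrt)).mul_const (ρ ^ a)
  refine ⟨_, (tendsto_add_atTop_iff_nat a).1 (hL.congr' ?_)⟩
  filter_upwards [eventually_gt_atTop 0] with N hN
  have hN' : (0 : ℝ) < N := by positivity
  have hN2 : (0 : ℝ) < ((N + a : ℕ) : ℝ) := by positivity
  have hs1 := Real.sqrt_pos.2 hN'
  have hs2 := Real.sqrt_pos.2 hN2
  simp only [Pi.div_apply]
  rw [PowerSeries.coeff_X_pow_mul, Real.sqrt_div hN2.le, pow_add]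
  by_cases h0 : PowerSeries.coeff (N + a) T = 0
  · simp [h0]
  · field_simp

end LocalLimit
end

/-! ### Total variation on finite spaces -/

noncomputable section

section TotalVariation

variable {α : Type*} [MeasurableSpace α]

theorem abs_real_sub_le_tvDist (μ ν : Measure α) [IsFiniteMeasure μ] [IsFiniteMeasure ν]
    {A : Set α} (hA : MeasurableSet A) : |μ.real A - ν.real A| ≤ tvDist μ ν := by
  refine le_ciSup (f := fun A : {A : Set α // MeasurableSet A} => |μ.real A.1 - ν.real A.1|)
    ⟨μ.real Set.univ + ν.real Set.univ, ?_⟩ ⟨A, hA⟩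
  rintro _ ⟨B, rfl⟩
  have h1 : μ.real B.1 ≤ μ.real Set.univ := measureReal_mono (Set.subset_univ _)
  have h2 : ν.real B.1 ≤ ν.real Set.univ := measureReal_mono (Set.subset_univ _)
  have h3 : 0 ≤ μ.real B.1 := measureReal_nonneg
  have h4 : 0 ≤ ν.real B.1 := measureReal_nonneg
  exact abs_le.2 ⟨by linarith, by linarith⟩

theorem tvDist_le_sum [Fintype α] [MeasurableSingletonClass α] (μ ν : Measure α)
    [IsFiniteMeasure μ] [IsFiniteMeasure ν] :
    tvDist μ ν ≤ ∑ a, |μ.real {a} - ν.real {a}| := by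
  classical
  have : Nonempty {A : Set α // MeasurableSet A} := ⟨⟨∅, MeasurableSet.empty⟩⟩
  refine ciSup_le fun A => ?_
  have h : ∀ ρ : Measure α, IsFiniteMeasure ρ → ρ.real A.1 = ∑ a ∈ A.1.toFinset, ρ.real {a} := by
    intro ρ _
    rw [sum_measureReal_singleton, Set.coe_toFinset]
  rw [h μ inferInstance, h ν inferInstance, ← Finset.sum_sub_distrib]
  exact (Finset.abs_sum_le_sum_abs _ _).trans
    (Finset.sum_le_sum_of_subset_of_nonneg (Finset.subset_univ _) fun _ _ _ => abs_nonneg _)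

/-- On a finite space convergence in total variation is convergence of the point masses. -/
theorem tendsto_tvDist_iff [Finite α] [MeasurableSingletonClass α] {ι : Type*} {l : Filter ι}
    {μ : ι → Measure α} [∀ i, IsFiniteMeasure (μ i)] {ν : Measure α} [IsFiniteMeasure ν] :
    Tendsto (fun i => tvDist (μ i) ν) l (𝓝 0) ↔
      ∀ a, Tendsto (fun i => (μ i).real {a}) l (𝓝 (ν.real {a})) := by
  have := Fintype.ofFinite α
  constructor
  · intro h a
    rw [tendsto_iff_dist_tendsto_zero]
    exact squeeze_zero (fun _ => dist_nonneg)
      (fun i => abs_real_sub_le_tvDist (μ i) ν (measurableSet_singleton a)) h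
  · intro h
    refine squeeze_zero (fun i => Real.iSup_nonneg fun _ => abs_nonneg _)
      (fun i => tvDist_le_sum (μ i) ν) ?_
    rw [← Finset.sum_const_zero (s := (Finset.univ : Finset α))]
    exact tendsto_finsetSum _ fun a _ => tendsto_iff_dist_tendsto_zero.1 (h a)

theorem real_sum_ofReal_smul_dirac [Fintype α] [MeasurableSingletonClass α] (f : α → ℝ)
    (hf : ∀ a, 0 ≤ f a) (a : α) :
    (∑ b, ENNReal.ofReal (f b) • Measure.dirac b : Measure α).real {a} = f a := by
  classical
  rw [measureReal_def, Measure.finsetSum_apply, Finset.sum_eq_single a]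
  · simp [hf a]
  · intro b _ hb
    simp [hb]
  · simp

end TotalVariation

/-! ### Truncation classes of large trees -/

namespace PlaneTree

variable {D : ℕ}

instance : DiscreteMeasurableSpace (PlaneTree D) := ⟨fun _ => trivial⟩

theorem trunc_trunc_succ (n : ℕ) (T : PlaneTree D) : (T.trunc (n + 1)).trunc n = T.trunc n := by
  induction n generalizing T with
  | zero => rfl
  | succ n ih =>
    obtain ⟨k, c⟩ := T
    simpa [trunc] using funext fun i => ih (c i)

/-- Only finitely many trees have height below n, so their orders are bounded. -/
theorem eventually_le_height (D n : ℕ) :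
    ∀ᶠ N in atTop, ∀ T : PlaneTree D, T.order = N → n ≤ T.height := by
  obtain ⟨M, hM⟩ := ((finite_height_lt (D := D) n).image order).bddAbove
  filter_upwards [eventually_gt_atTop M] with N hN T hT
  by_contra h
  have := hM ⟨T, not_le.1 h, rfl⟩
  omega

theorem exists_order_eq (hD : 1 ≤ D) (N : ℕ) : ∃ T : PlaneTree D, T.order = N + 1 := by
  induction N with
  | zero => exact ⟨node 0 Fin.elim0, order_node (0 : Fin (D + 1)) (fun i => i.elim0)⟩
  | succ N ih =>
    obtain ⟨T, hT⟩ := ih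
    exact ⟨node ⟨1, by omega⟩ fun _ => T, by simp [order_node, hT]⟩

theorem coe_weight_exp (E : Fin (D + 1) → ℝ) (β : ℝ) (T : PlaneTree D) :
    (T.weight (fun k => (Real.exp (-β * E k)).toNNReal) : ℝ) = Real.exp (-β * T.energy E) := by
  rw [weight, energy]
  induction T.degrees using Multiset.induction_on with
  | empty => simp
  | cons k s ih =>
    rw [Multiset.map_cons, Multiset.prod_cons, NNReal.coe_mul, ih, Multiset.map_cons,
      Multiset.sum_cons, mul_add, Real.exp_add, Real.coe_toNNReal _ (Real.exp_pos _).le]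

theorem orderWeight_congr (w : Fin (D + 1) → NNReal) {S S' : Set (PlaneTree D)} {N : ℕ}
    (h : ∀ T : PlaneTree D, T.order = N → (T ∈ S ↔ T ∈ S')) :
    orderWeight w S N = orderWeight w S' N := by
  classical
  refine Finset.sum_congr rfl fun T _ => ?_
  simp only [Set.indicator_apply, h T.1 T.2]

theorem sum_orderWeight_trunc_eq (w : Fin (D + 1) → NNReal) {n N : ℕ}
    (s : Finset (TreesOfHeight D n)) :
    ∑ τ ∈ s, orderWeight w {T | T.trunc n = τ.1} N =
      orderWeight w {T | ∃ τ ∈ s, T.trunc n = τ.1} N := by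
  classical
  simp only [orderWeight]
  rw [Finset.sum_comm]
  refine Finset.sum_congr rfl fun T _ => ?_
  by_cases h : ∃ τ ∈ s, T.1.trunc n = τ.1
  · obtain ⟨τ, hτ, hT⟩ := h
    rw [Set.indicator_of_mem (show T.1 ∈ {T | ∃ τ ∈ s, T.trunc n = τ.1} from ⟨τ, hτ, hT⟩),
      Finset.sum_eq_single_of_mem τ hτ]
    · exact Set.indicator_of_mem (show T.1 ∈ {T : PlaneTree D | T.trunc n = τ.1} from hT) _
    · intro σ _ hσ
      refine Set.indicator_of_notMem (fun h => hσ (Subtype.ext ?_)) _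
      exact (show T.1.trunc n = σ.1 from h).symm.trans hT
  · rw [Set.indicator_of_notMem (show T.1 ∉ {T | ∃ τ ∈ s, T.trunc n = τ.1} from h)]
    exact Finset.sum_eq_zero fun τ hτ => Set.indicator_of_notMem
      (show T.1 ∉ {T : PlaneTree D | T.trunc n = τ.1} from fun hT => h ⟨τ, hτ, hT⟩) _

theorem eventually_sum_orderWeight_trunc_eq (w : Fin (D + 1) → NNReal) (n : ℕ) :
    ∀ᶠ N in atTop, ∑ τ : TreesOfHeight D n, orderWeight w {T | T.trunc n = τ.1} N =
      orderWeight w Set.univ N := by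
  filter_upwards [eventually_le_height D n] with N hN
  rw [sum_orderWeight_trunc_eq]
  refine orderWeight_congr w fun T hT => iff_of_true ?_ trivial
  exact ⟨⟨T.trunc n, by rw [height_trunc, min_eq_left (hN T hT)]⟩, Finset.mem_univ _, rfl⟩

-- The class of τ is partitioned by the neighbourhoods of radius n + 1; for large N these all have
-- height exactly n + 1, so none is missed.
open Classical in
theorem eventually_sum_orderWeight_trunc_succ_eq (w : Fin (D + 1) → NNReal) (n : ℕ)
    (τ : TreesOfHeight D n) :
    ∀ᶠ N in atTop, ∑ τ' : TreesOfHeight D (n + 1) with truncHeight n τ' = τ,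
      orderWeight w {T | T.trunc (n + 1) = τ'.1} N = orderWeight w {T | T.trunc n = τ.1} N := by
  filter_upwards [eventually_le_height D (n + 1)] with N hN
  rw [sum_orderWeight_trunc_eq]
  refine orderWeight_congr w fun T hT => ⟨?_, fun h => ?_⟩
  · rintro ⟨τ', hτ', h⟩
    rw [Finset.mem_filter] at hτ'
    change T.trunc n = τ.1
    rw [← trunc_trunc_succ, h, ← hτ'.2]
    rfl
  · refine ⟨⟨T.trunc (n + 1), by rw [height_trunc, min_eq_left (hN T hT)]⟩, ?_, rfl⟩
    rw [Finset.mem_filter]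
    exact ⟨Finset.mem_univ _, Subtype.ext ((trunc_trunc_succ n T).trans h)⟩

/-- For D = 1 the trees are paths. This replaces the asymptotics in the one case without a critical
tilt. -/
theorem subsingleton_treesOfHeight_one (n : ℕ) : Subsingleton (TreesOfHeight 1 n) := by
  suffices h : ∀ T T' : PlaneTree 1, T.height = T'.height → T = T' from
    ⟨fun T T' => Subtype.ext (h _ _ (T.2.trans T'.2.symm))⟩
  intro T
  induction T with
  | node k c ih =>
    rintro ⟨k', c'⟩ h
    fin_cases k <;> fin_cases k'
    · congr 1
      exact funext fun i => i.elim0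
    · simp [height] at h
    · simp [height] at h
    · congr 1
      funext i
      refine ih i _ ?_
      have hi : i = (0 : Fin 1) := Subsingleton.elim (α := Fin 1) _ _
      subst hi
      change (Finset.univ : Finset (Fin 1)).sup (fun i => (c i).height + 1) =
        (Finset.univ : Finset (Fin 1)).sup (fun i => (c' i).height + 1) at h
      simpa using h

end PlaneTree

/-! ### Limits of the truncated Gibbs measures -/

section Gibbs

open PlaneTree

variable {D : ℕ} (E : Fin (D + 1) → ℝ) (β : ℝ)

/-- The Boltzmann weights `exp (-β E k)`. -/
def boltzmann (k : Fin (D + 1)) : NNReal := (Real.exp (-β * E k)).toNNReal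

theorem partitionFunction_eq (N : ℕ) :
    partitionFunction E β N = orderWeight (boltzmann E β) Set.univ N := by
  simp only [partitionFunction, orderWeight, Set.indicator_univ, NNReal.coe_sum]
  exact Finset.sum_congr rfl fun T _ => (coe_weight_exp E β T.1).symm

instance (N : ℕ) : IsFiniteMeasure (gibbsMeasure E β N) := by
  constructor
  rw [gibbsMeasure, Measure.finsetSum_apply]
  refine ENNReal.sum_lt_top.2 fun T _ => ?_
  simp

theorem truncatedGibbsMeasure_singleton (n N : ℕ) (τ : TreesOfHeight D n) :
    truncatedGibbsMeasure E β n N {τ} =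
      ENNReal.ofReal (orderWeight (boltzmann E β) {T | T.trunc n = τ.1} N /
        orderWeight (boltzmann E β) Set.univ N) := by
  have hmeas : Measurable fun T : TreesOfOrder D N => T.1.trunc n :=
    (Measurable.of_discrete (f := trunc n)).comp measurable_subtype_coe
  rw [truncatedGibbsMeasure, Measure.comap_apply _ Subtype.val_injective (fun _ _ => .of_discrete) _
    (measurableSet_singleton τ), Set.image_singleton, Measure.map_apply hmeas .of_discrete,
    gibbsMeasure, Measure.finsetSum_apply, ← partitionFunction_eq]
  simp only [orderWeight, NNReal.coe_sum, Finset.sum_div]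
  have hZ : 0 ≤ partitionFunction E β N := Finset.sum_nonneg fun _ _ => (Real.exp_pos _).le
  rw [ENNReal.ofReal_sum_of_nonneg fun T _ => div_nonneg (NNReal.coe_nonneg _) hZ]
  refine Finset.sum_congr rfl fun T _ => ?_
  rw [Measure.smul_apply, Measure.dirac_apply' _ (hmeas .of_discrete)]
  by_cases h : T.1.trunc n = τ.1
  · rw [Set.indicator_of_mem (by exact h),
      Set.indicator_of_mem (show T.1 ∈ {T : PlaneTree D | T.trunc n = τ.1} from h), ← coe_weight_exp,
      Pi.one_apply, smul_eq_mul, mul_one]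
    rfl
  · rw [Set.indicator_of_notMem (by exact h),
      Set.indicator_of_notMem (show T.1 ∉ {T : PlaneTree D | T.trunc n = τ.1} from h)]
    simp

instance (n N : ℕ) : IsFiniteMeasure (truncatedGibbsMeasure E β n N) := by
  constructor
  rw [← Finset.coe_univ, ← sum_measure_singleton]
  refine ENNReal.sum_lt_top.2 fun τ _ => ?_
  rw [truncatedGibbsMeasure_singleton]
  exact ENNReal.ofReal_lt_top

theorem truncatedGibbsMeasure_real_singleton (n N : ℕ) (τ : TreesOfHeight D n) :
    (truncatedGibbsMeasure E β n N).real {τ} =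
      orderWeight (boltzmann E β) {T | T.trunc n = τ.1} N /
        orderWeight (boltzmann E β) Set.univ N := by
  rw [measureReal_def, truncatedGibbsMeasure_singleton, ENNReal.toReal_ofReal (by positivity)]

theorem eventually_sum_truncatedGibbsMeasure_real_singleton (hD : 1 ≤ D) (n : ℕ) :
    ∀ᶠ N in atTop, ∑ τ, (truncatedGibbsMeasure E β n N).real {τ} = 1 := by
  filter_upwards [eventually_sum_orderWeight_trunc_eq (boltzmann E β) n, eventually_gt_atTop 0]
    with N hN h0
  simp only [truncatedGibbsMeasure_real_singleton]
  rw [← Finset.sum_div, ← NNReal.coe_sum, hN, ← partitionFunction_eq]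
  refine div_self (ne_of_gt (Finset.sum_pos (fun _ _ => Real.exp_pos _) ?_))
  obtain ⟨T, hT⟩ := exists_order_eq hD (N - 1)
  exact ⟨⟨T, by omega⟩, Finset.mem_univ _⟩

theorem exists_tendsto_truncatedGibbsMeasure_real_singleton (hD : 1 ≤ D) (n : ℕ)
    (τ : TreesOfHeight D n) :
    ∃ L, Tendsto (fun N => (truncatedGibbsMeasure E β n N).real {τ}) atTop (𝓝 L) := by
  rcases hD.eq_or_lt with rfl | hD2
  · have := subsingleton_treesOfHeight_one n
    refine ⟨1, tendsto_const_nhds.congr' ?_⟩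
    filter_upwards [eventually_sum_truncatedGibbsMeasure_real_singleton E β hD n] with N hN
    rw [Fintype.sum_subsingleton _ τ] at hN
    exact hN.symm
  · obtain ⟨W, a, m, h⟩ := exists_orderWeight_trunc_eq (boltzmann E β) n τ.1
    obtain ⟨L, hL⟩ := LocalLimit.exists_tendsto_coeff_div (fun k => (boltzmann E β k : ℝ))
      (fun k => by simp [boltzmann, Real.exp_pos]) hD2 (partitionGF_eq (boltzmann E β)) a m
    refine ⟨W * L, (hL.const_mul W).congr fun N => ?_⟩
    rw [truncatedGibbsMeasure_real_singleton, h, mul_div_assoc]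
    simp only [partitionGF, PowerSeries.coeff_mk]

theorem exists_isLimitMeasure (hD : 1 ≤ D) (n : ℕ) : ∃ P, IsLimitMeasure E β n P := by
  choose L hL using exists_tendsto_truncatedGibbsMeasure_real_singleton E β hD n
  have hL0 : ∀ τ, 0 ≤ L τ := fun τ =>
    ge_of_tendsto' (hL τ) fun N => measureReal_nonneg
  -- The sum is finite, so the total mass 1, attained for all large N, survives in the limit.
  have hL1 : ∑ τ, L τ = 1 := tendsto_nhds_unique (tendsto_finsetSum _ fun τ _ => hL τ)
    (tendsto_const_nhds.congr' ((eventually_sum_truncatedGibbsMeasure_real_singleton E β hD n).mono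
      fun _ h => h.symm))
  have hP : IsProbabilityMeasure
      (∑ τ, ENNReal.ofReal (L τ) • Measure.dirac τ : Measure (TreesOfHeight D n)) := by
    constructor
    rw [Measure.finsetSum_apply]
    simp only [Measure.smul_apply, measure_univ, smul_eq_mul, mul_one]
    rw [← ENNReal.ofReal_sum_of_nonneg fun τ _ => hL0 τ, hL1, ENNReal.ofReal_one]
  refine ⟨_, hP, tendsto_tvDist_iff.2 fun τ => ?_⟩
  rw [real_sum_ofReal_smul_dirac L hL0]
  exact hL τ

variable {E β}

theorem IsLimitMeasure.tendsto_real_singleton {n : ℕ} {P : Measure (TreesOfHeight D n)}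
    (hP : IsLimitMeasure E β n P) (τ : TreesOfHeight D n) :
    Tendsto (fun N => (truncatedGibbsMeasure E β n N).real {τ}) atTop (𝓝 (P.real {τ})) :=
  have := hP.1
  tendsto_tvDist_iff.1 hP.2 τ

theorem IsLimitMeasure.unique {n : ℕ} {P Q : Measure (TreesOfHeight D n)}
    (hP : IsLimitMeasure E β n P) (hQ : IsLimitMeasure E β n Q) : P = Q := by
  have := hP.1
  have := hQ.1
  refine Measure.ext_of_singleton fun τ => ?_
  rw [← measureReal_eq_measureReal_iff]
  exact tendsto_nhds_unique (hP.tendsto_real_singleton τ) (hQ.tendsto_real_singleton τ)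

open Classical in
theorem IsLimitMeasure.apply_singleton_eq_sum {n : ℕ} {P : Measure (TreesOfHeight D n)}
    {Q : Measure (TreesOfHeight D (n + 1))} (hP : IsLimitMeasure E β n P)
    (hQ : IsLimitMeasure E β (n + 1) Q) (τ : TreesOfHeight D n) :
    P {τ} = ∑ τ' : TreesOfHeight D (n + 1) with truncHeight n τ' = τ, Q {τ'} := by
  have := hP.1
  have := hQ.1
  have h : P.real {τ} =
      ∑ τ' : TreesOfHeight D (n + 1) with truncHeight n τ' = τ, Q.real {τ'} := by
    refine tendsto_nhds_unique (hP.tendsto_real_singleton τ)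
      ((tendsto_finsetSum _ fun τ' _ => hQ.tendsto_real_singleton τ').congr' ?_)
    filter_upwards [eventually_sum_orderWeight_trunc_succ_eq (boltzmann E β) n τ] with N hN
    simp only [truncatedGibbsMeasure_real_singleton]
    rw [← Finset.sum_div, ← NNReal.coe_sum, hN]
  rw [← ofReal_measureReal, h, ENNReal.ofReal_sum_of_nonneg fun _ _ => measureReal_nonneg]
  exact Finset.sum_congr rfl fun _ _ => ofReal_measureReal

end Gibbs

end
open Classical in
theorem theorem3 (D : ℕ) (hD : 1 ≤ D) (E : Fin (D + 1) → ℝ) (β : ℝ) :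
    (∀ n : ℕ, ∃! P : Measure (TreesOfHeight D n), IsLimitMeasure E β n P) ∧
    ∀ P : (n : ℕ) → Measure (TreesOfHeight D n), (∀ n, IsLimitMeasure E β n (P n)) →
      ∀ (n : ℕ) (τ : TreesOfHeight D n),
        P n {τ} = ∑ τ' : TreesOfHeight D (n + 1) with truncHeight n τ' = τ, P (n + 1) {τ'} := by
  refine ⟨fun n => ?_, fun P hP n τ => (hP n).apply_singleton_eq_sum (hP (n + 1)) τ⟩
  obtain ⟨P, hP⟩ := exists_isLimitMeasure E β hD n
  exact ⟨P, hP, fun Q hQ => hQ.unique hP⟩
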